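/- A rational hyperplane of $\mathbb{R}^d$ is a set $\{y\in\mathbb{R}^d : a_1y_1+\dots+a_dy_d=b\}$ with $(a_1,\dots,a_d)\in\mathbb{Q}^d\setminus\{0\}$ and $b\in\mathbb{Q}$; a vector is totally irrational if it lies on no rational hyperplane. The uniform exponent $\hat\sigma(x)\in[-\infty,+\infty]$ of $x\in\mathbb{R}^d$ is the supremum of the real numbers $s$ such that for all sufficiently large real $Q$ the system $$\|qx-p\|_\infty<Q^{-s},\qquad 0<q\le Q,$$ has a solution $(p,q)\in\mathbb{Z}^d\times\mathbb{Z}$, where $\|\cdot\|_\infty$ is the sup-norm. There exists a real number $0<\sigma<1$ with the following property. For all integers $d,k$ with $1\le k<d$ there are uncountably many connected (embedded) real-analytic $k$-dimensional submanifolds $\mathcal{M}\subset\mathbb{R}^d$ such that $\mathcal{M}$ is not contained in any rational hyperplane and $\mathcal{M}$ contains no totally irrational vector $x$ with $\hat\sigma(x)\ge\sigma$. -/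

import Mathlib

open Set Filter

/-- A rational (affine) hyperplane of `ℝ^d`: the solution set of one nontrivial affine equation
`a₁ y₁ + ⋯ + a_d y_d = b` with rational coefficients. -/
def IsRationalHyperplane {d : ℕ} (H : Set (Fin d → ℝ)) : Prop :=
  ∃ (a : Fin d → ℚ) (b : ℚ), a ≠ 0 ∧ H = {y | ∑ i, (a i : ℝ) * y i = (b : ℝ)}

/-- A vector is totally irrational if it lies on no rational hyperplane. -/
def IsTotallyIrrational {d : ℕ} (x : Fin d → ℝ) : Prop :=
  ∀ H : Set (Fin d → ℝ), IsRationalHyperplane H → x ∉ H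

/-- For all sufficiently large `Q` there is an integer solution `(p, q)` of
`‖q x - p‖ < Q ^ (-s)`, `0 < q ≤ Q`, where `‖ ‖` is the sup-norm
(the norm that Mathlib puts on `Fin d → ℝ`). -/
def IsUniformlyApproximable {d : ℕ} (x : Fin d → ℝ) (s : ℝ) : Prop :=
  ∀ᶠ Q : ℝ in atTop, ∃ (p : Fin d → ℤ) (q : ℤ), 0 < q ∧ (q : ℝ) ≤ Q ∧
    ‖(q : ℝ) • x - (fun i => (p i : ℝ))‖ < Q ^ (-s)

/-- The uniform exponent of `x` with respect to the sup-norm: the supremum, possibly `+∞`, of the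
real `s` for which `x` is uniformly approximable with exponent `s`. -/
noncomputable def uniformExponent {d : ℕ} (x : Fin d → ℝ) : EReal :=
  sSup {e : EReal | ∃ s : ℝ, e = (s : EReal) ∧ IsUniformlyApproximable x s}

/-- The totally irrational vectors whose uniform exponent is at least `s`. -/
def totallyIrrationalUniformSet (d : ℕ) (s : ℝ) : Set (Fin d → ℝ) :=
  {x | (s : EReal) ≤ uniformExponent x ∧ IsTotallyIrrational x}

/-- `M` is an (embedded) `k`-dimensional real-analytic submanifold of `ℝ^d`: around every point of
`M` there is a real-analytic change of coordinates of `ℝ^d`, with real-analytic inverse, that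
straightens `M` to the coordinate subspace `ℝ^k × {0}`. -/
def IsAnalyticSubmanifold {d : ℕ} (k : ℕ) (M : Set (Fin d → ℝ)) : Prop :=
  k ≤ d ∧ ∀ x ∈ M, ∃ φ : OpenPartialHomeomorph (Fin d → ℝ) (Fin d → ℝ),
    x ∈ φ.source ∧ AnalyticOnNhd ℝ φ φ.source ∧ AnalyticOnNhd ℝ φ.symm φ.target ∧
    ∀ y ∈ φ.source, y ∈ M ↔ ∀ i : Fin d, k ≤ (i : ℕ) → φ y i = 0

/-! Take the manifolds `x i = (x z) ^ (i - k + 2) + c` for `i ≥ k`, where `z` is coordinate 0; only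
`β = α ^ 2 + c` with `α = x z`, `β = x k` matters for approximation. If `x` is totally irrational,
three consecutive best approximations `(q, p, r)` of `(α, β)` are independent infinitely often.
Their determinant is then at least 1 in absolute value, so a uniform exponent near 1 forces the next
denominator to be huge and the middle error to be `O(q ^ (-4))` (`frequently_simulError_le`). Then
`(q r - p ^ 2) / q ^ 2` approximates `c` within `O(q ^ (-5))`, a power 5/2 > 2 of its denominator
(`liouvilleWith_sub_sq`). Almost every `c` admits no such approximation, which leaves uncountably
many manifolds. -/

/-! ### Records of an error function -/

/-- `q` is a record of `e` if `e q` is smaller than all earlier values at positive integers. -/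
def IsRecord (e : ℕ → ℝ) (q : ℕ) : Prop :=
  0 < q ∧ ∀ r, 0 < r → r < q → e q < e r

theorem infinite_setOf_isRecord {e : ℕ → ℝ} (hpos : ∀ q, 0 < q → 0 < e q)
    (hsmall : ∀ ε > 0, ∃ q, 0 < q ∧ e q < ε) : {q | IsRecord e q}.Infinite := by
  classical
  refine Set.infinite_of_not_bddAbove ?_
  rintro ⟨N, hN⟩
  obtain ⟨r₀, hr₀, hmin⟩ := Finset.exists_min_image (Finset.Icc 1 (N + 1)) e ⟨1, by simp⟩
  have hr₀' : 0 < r₀ := (Finset.mem_Icc.1 hr₀).1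
  have hex := hsmall (e r₀) (hpos r₀ hr₀')
  obtain ⟨hq, hlt⟩ := Nat.find_spec hex
  have hrec : IsRecord e (Nat.find hex) := by
    refine ⟨hq, fun r hr hrq => ?_⟩
    have := Nat.find_min hex hrq
    push Not at this
    exact hlt.trans_le (this hr)
  have hle : Nat.find hex ≤ N := hN hrec
  exact absurd hlt (not_lt.2 (hmin _ (Finset.mem_Icc.2 ⟨hq, by omega⟩)))

/-- A non-record is matched or beaten by a smaller index, so descent ends at a record, which is at
most the `n`-th. -/
theorem apply_nth_isRecord_le {e : ℕ → ℝ} (hinf : {q | IsRecord e q}.Infinite) (n : ℕ) :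
    ∀ r, 0 < r → r < Nat.nth (IsRecord e) (n + 1) → e (Nat.nth (IsRecord e) n) ≤ e r := by
  intro r
  induction r using Nat.strong_induction_on with
  | _ r ih =>
    intro hr hlt
    by_cases hrec : IsRecord e r
    · rcases (Nat.le_nth_of_lt_nth_succ hlt hrec).eq_or_lt with h | h
      · rw [h]
      · exact ((Nat.nth_mem_of_infinite hinf n).2 r hr h).le
    · simp only [IsRecord, hr, true_and] at hrec
      push Not at hrec
      obtain ⟨r', h0, h1, h2⟩ := hrec
      exact (ih r' h1 h0 (h1.trans hlt)).trans h2

/-! ### Determinants of consecutive best approximations -/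

/-- The simultaneous distance of `q α` and `q β` to the nearest integers. -/
noncomputable def simulError (α β : ℝ) (q : ℕ) : ℝ :=
  max |(q : ℝ) * α - round ((q : ℝ) * α)| |(q : ℝ) * β - round ((q : ℝ) * β)|

theorem simulError_le_half (α β : ℝ) (q : ℕ) : simulError α β q ≤ 1 / 2 :=
  max_le (abs_sub_round _) (abs_sub_round _)

theorem simulError_pos {α β : ℝ}
    (hind : ∀ a b c : ℤ, (a : ℝ) + b * α + c * β = 0 → a = 0 ∧ b = 0 ∧ c = 0)
    {q : ℕ} (hq : 0 < q) : 0 < simulError α β q := by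
  refine lt_max_of_lt_left (abs_pos.2 fun h => ?_)
  have := (hind (-round ((q : ℝ) * α)) q 0 (by push_cast; linarith)).2.1
  omega

/-- The determinant of three integer vectors `(q, p, r)`. -/
def intDet (q₁ p₁ r₁ q₂ p₂ r₂ q₃ p₃ r₃ : ℤ) : ℤ :=
  q₁ * (p₂ * r₃ - p₃ * r₂) - q₂ * (p₁ * r₃ - p₃ * r₁) + q₃ * (p₁ * r₂ - p₂ * r₁)

theorem abs_mul_sub_mul_le {a b c d L M : ℝ} (ha : |a| ≤ L) (hb : |b| ≤ M) (hc : |c| ≤ M)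
    (hd : |d| ≤ L) : |a * b - c * d| ≤ 2 * (L * M) := by
  have hL : 0 ≤ L := (abs_nonneg _).trans ha
  have hM : 0 ≤ M := (abs_nonneg _).trans hb
  have h1 : |a * b| ≤ L * M := by
    rw [abs_mul]; exact mul_le_mul ha hb (abs_nonneg _) hL
  have h2 : |c * d| ≤ L * M := by
    rw [abs_mul, mul_comm L]; exact mul_le_mul hc hd (abs_nonneg _) hM
  linarith [abs_sub (a * b) (c * d)]

/-- Column operations replace `p`, `r` by the errors `q α - p`, `q β - r`; only the first vector has
errors of size `L`, so each 2×2 minor is at most `2 L M`. -/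
theorem abs_intDet_le {α β : ℝ} {q₁ p₁ r₁ q₂ p₂ r₂ q₃ p₃ r₃ : ℤ} {L M : ℝ}
    (hq₁ : 0 ≤ q₁) (hq₂ : 0 ≤ q₂) (hq₁₃ : q₁ ≤ q₃) (hq₂₃ : q₂ ≤ q₃)
    (hML : M ≤ L) (hp₁ : |(q₁ : ℝ) * α - p₁| ≤ L) (hr₁ : |(q₁ : ℝ) * β - r₁| ≤ L)
    (hp₂ : |(q₂ : ℝ) * α - p₂| ≤ M) (hr₂ : |(q₂ : ℝ) * β - r₂| ≤ M)
    (hp₃ : |(q₃ : ℝ) * α - p₃| ≤ M) (hr₃ : |(q₃ : ℝ) * β - r₃| ≤ M) :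
    |(intDet q₁ p₁ r₁ q₂ p₂ r₂ q₃ p₃ r₃ : ℝ)| ≤ 6 * (q₃ * (L * M)) := by
  have key : (intDet q₁ p₁ r₁ q₂ p₂ r₂ q₃ p₃ r₃ : ℝ) =
      q₁ * ((q₂ * α - p₂) * (q₃ * β - r₃) - (q₃ * α - p₃) * (q₂ * β - r₂))
      - q₂ * ((q₁ * α - p₁) * (q₃ * β - r₃) - (q₃ * α - p₃) * (q₁ * β - r₁))
      + q₃ * ((q₁ * α - p₁) * (q₂ * β - r₂) - (q₂ * α - p₂) * (q₁ * β - r₁)) := by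
    simp only [intDet]; push_cast; ring
  have g₁ : (0 : ℝ) ≤ q₁ := by exact_mod_cast hq₁
  have g₂ : (0 : ℝ) ≤ q₂ := by exact_mod_cast hq₂
  have g₁₃ : (q₁ : ℝ) ≤ q₃ := by exact_mod_cast hq₁₃
  have g₂₃ : (q₂ : ℝ) ≤ q₃ := by exact_mod_cast hq₂₃
  have bound : ∀ {t x : ℝ}, 0 ≤ t → t ≤ q₃ → |x| ≤ 2 * (L * M) →
      |t * x| ≤ 2 * (q₃ * (L * M)) := by
    intro t x ht ht' hx
    rw [abs_mul, abs_of_nonneg ht]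
    calc t * |x| ≤ q₃ * (2 * (L * M)) := mul_le_mul ht' hx (abs_nonneg _) (ht.trans ht')
      _ = _ := by ring
  have b₁ := bound g₁ g₁₃ (abs_mul_sub_mul_le (hp₂.trans hML) hr₃ hp₃ (hr₂.trans hML))
  have b₂ := bound g₂ g₂₃ (abs_mul_sub_mul_le hp₁ hr₃ hp₃ hr₁)
  have b₃ := bound (g₁.trans g₁₃) le_rfl (abs_mul_sub_mul_le hp₁ hr₂ hp₂ hr₁)
  rw [key]
  rw [abs_le] at b₁ b₂ b₃ ⊢
  constructor <;> linarith [b₁.1, b₁.2, b₂.1, b₂.2, b₃.1, b₃.2]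

/-- A linear form that vanishes on two independent vectors vanishes on every vector that
is coplanar with them. -/
theorem form_eq_zero_of_intDet_eq_zero {a b c q₁ p₁ r₁ q₂ p₂ r₂ q₃ p₃ r₃ : ℤ}
    (h₁ : a * q₁ + b * p₁ + c * r₁ = 0) (h₂ : a * q₂ + b * p₂ + c * r₂ = 0)
    (hind : q₁ * p₂ - q₂ * p₁ ≠ 0 ∨ q₁ * r₂ - q₂ * r₁ ≠ 0)
    (hdet : intDet q₁ p₁ r₁ q₂ p₂ r₂ q₃ p₃ r₃ = 0) : a * q₃ + b * p₃ + c * r₃ = 0 := by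
  unfold intDet at hdet
  rcases hind with h | h
  · refine (mul_eq_zero.1 (?_ : (q₁ * p₂ - q₂ * p₁) * (a * q₃ + b * p₃ + c * r₃) = 0)).resolve_left h
    linear_combination c * hdet + (q₃ * p₂ - p₃ * q₂) * h₁ + (p₃ * q₁ - q₃ * p₁) * h₂
  · refine (mul_eq_zero.1 (?_ : (q₁ * r₂ - q₂ * r₁) * (a * q₃ + b * p₃ + c * r₃) = 0)).resolve_left h
    linear_combination (-b) * hdet + (q₃ * r₂ - r₃ * q₂) * h₁ + (r₃ * q₁ - q₃ * r₁) * h₂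

/-- Integer vectors with growing denominator and shrinking error are not proportional. -/
theorem independent_of_simulError_lt {α β : ℝ} {q q' : ℕ} (hqq : q < q')
    (hlt : simulError α β q' < simulError α β q) :
    (q : ℤ) * round ((q' : ℝ) * α) - q' * round ((q : ℝ) * α) ≠ 0 ∨
      (q : ℤ) * round ((q' : ℝ) * β) - q' * round ((q : ℝ) * β) ≠ 0 := by
  by_contra hcon
  push Not at hcon
  have scale : ∀ x : ℝ, (q : ℤ) * round ((q' : ℝ) * x) - q' * round ((q : ℝ) * x) = 0 →
      (q' : ℝ) * |(q : ℝ) * x - round ((q : ℝ) * x)| =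
        q * |(q' : ℝ) * x - round ((q' : ℝ) * x)| := by
    intro x hx
    have hx' : (q : ℝ) * round ((q' : ℝ) * x) - q' * round ((q : ℝ) * x) = 0 := by
      exact_mod_cast hx
    rw [← Nat.abs_cast q', ← Nat.abs_cast q, ← abs_mul, ← abs_mul, Nat.abs_cast, Nat.abs_cast]
    congr 1
    linear_combination hx'
  have h : (q' : ℝ) * simulError α β q = q * simulError α β q' := by
    unfold simulError
    rw [mul_max_of_nonneg _ _ (Nat.cast_nonneg _), mul_max_of_nonneg _ _ (Nat.cast_nonneg _),
      scale α hcon.1, scale β hcon.2]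
  have h0 : 0 ≤ simulError α β q' := (abs_nonneg _).trans (le_max_left _ _)
  have hqq' : (q : ℝ) < q' := by exact_mod_cast hqq
  have : (q : ℝ) * simulError α β q' ≤ q' * simulError α β q' :=
    mul_le_mul_of_nonneg_right hqq'.le h0
  have : (q' : ℝ) * simulError α β q' < q' * simulError α β q :=
    mul_lt_mul_of_pos_left hlt ((Nat.cast_nonneg q).trans_lt hqq')
  linarith

/-- Along a sequence of denominators with strictly decreasing errors, three consecutive
approximation vectors are linearly independent infinitely often. -/
theorem exists_intDet_ne_zero {α β : ℝ}
    (hind : ∀ a b c : ℤ, (a : ℝ) + b * α + c * β = 0 → a = 0 ∧ b = 0 ∧ c = 0)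
    {u : ℕ → ℕ} (hu : StrictMono u) (he : ∀ n, simulError α β (u (n + 1)) < simulError α β (u n))
    (N : ℕ) : ∃ n ≥ N,
      intDet (u n) (round ((u n : ℝ) * α)) (round ((u n : ℝ) * β))
        (u (n + 1)) (round ((u (n + 1) : ℝ) * α)) (round ((u (n + 1) : ℝ) * β))
        (u (n + 2)) (round ((u (n + 2) : ℝ) * α)) (round ((u (n + 2) : ℝ) * β)) ≠ 0 := by
  by_contra hcon
  push Not at hcon
  set P : ℕ → ℤ := fun n => round ((u n : ℝ) * α) with hP
  set R : ℕ → ℤ := fun n => round ((u n : ℝ) * β) with hR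
  -- `(a, b, c)` is the cross product of vectors `N` and `N + 1`. Vanishing determinants keep all
  -- later vectors in its orthogonal plane, and dividing by `u` yields a relation between 1, `α`,
  -- `β`.
  set a : ℤ := P N * R (N + 1) - P (N + 1) * R N with ha
  set b : ℤ := u (N + 1) * R N - u N * R (N + 1) with hb
  set c : ℤ := u N * P (N + 1) - u (N + 1) * P N with hc
  have hform : ∀ m, (a * u (N + m) + b * P (N + m) + c * R (N + m) = 0) ∧
      (a * u (N + m + 1) + b * P (N + m + 1) + c * R (N + m + 1) = 0) := by
    intro m
    induction m with
    | zero => constructor <;> simp only [ha, hb, hc, add_zero] <;> ring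
    | succ m ih =>
      exact ⟨ih.2, form_eq_zero_of_intDet_eq_zero ih.1 ih.2
        (independent_of_simulError_lt (hu (Nat.lt_succ_self _)) (he _))
        (hcon (N + m) (Nat.le_add_right _ _))⟩
  have hzero : (a : ℝ) + b * α + c * β = 0 := by
    by_contra hne
    have hs : 0 < |(a : ℝ) + b * α + c * β| := abs_pos.2 hne
    obtain ⟨m, hm⟩ := exists_nat_gt ((|(b : ℝ)| + |(c : ℝ)|) / |(a : ℝ) + b * α + c * β|)
    rw [div_lt_iff₀ hs] at hm
    have hz : (a : ℝ) * u (N + m) + b * P (N + m) + c * R (N + m) = 0 := by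
      exact_mod_cast (hform m).1
    have heq : (u (N + m) : ℝ) * ((a : ℝ) + b * α + c * β) =
        b * (u (N + m) * α - P (N + m)) + c * (u (N + m) * β - R (N + m)) := by
      linear_combination hz
    have h1 : |(u (N + m) : ℝ) * α - P (N + m)| ≤ 1 :=
      (abs_sub_round _).trans (by norm_num)
    have h2 : |(u (N + m) : ℝ) * β - R (N + m)| ≤ 1 :=
      (abs_sub_round _).trans (by norm_num)
    have hle : (u (N + m) : ℝ) * |(a : ℝ) + b * α + c * β| ≤ |(b : ℝ)| + |(c : ℝ)| := by
      rw [← Nat.abs_cast (u (N + m)), ← abs_mul, heq]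
      refine (abs_add_le _ _).trans ?_
      rw [abs_mul, abs_mul]
      exact add_le_add (mul_le_of_le_one_right (abs_nonneg _) h1)
        (mul_le_of_le_one_right (abs_nonneg _) h2)
    have hmu : (m : ℝ) ≤ u (N + m) := by
      exact_mod_cast (Nat.le_add_left m N).trans (hu.id_le _)
    exact absurd (hle.trans_lt hm) (not_lt.2 (mul_le_mul_of_nonneg_right hmu hs.le))
  obtain ⟨-, hb0, hc0⟩ := hind a b c hzero
  rcases independent_of_simulError_lt (hu (Nat.lt_succ_self N)) (he N) with h | h
  · exact h hc0
  · exact h (by simp only [hb, hR] at hb0; simp only [Nat.succ_eq_add_one]; linarith)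

/-! ### From uniform to ordinary exponent -/

/-- The exponent estimate that turns three independent consecutive approximations into a
very good one. -/
theorem pow_four_mul_le {u X e₁ e₂ : ℝ} (hu : 1 ≤ u) (hX : 1 ≤ X) (he₁ : 0 ≤ e₁) (he₂ : 0 ≤ e₂)
    (h₁ : e₁ < u ^ (-(9 / 10) : ℝ)) (h₂ : e₂ < X ^ (-(9 / 10) : ℝ))
    (hdet : 1 ≤ 6 * ((X + 1) * (e₁ * e₂))) : u ^ 4 * e₂ ≤ 12 ^ 9 := by
  have hu0 : 0 < u := by linarith
  have hX0 : 0 < X := by linarith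
  -- Tenth roots make all exponents integers.
  obtain ⟨v, hv, rfl⟩ : ∃ v : ℝ, 1 ≤ v ∧ u = v ^ 10 :=
    ⟨u ^ (1 / 10 : ℝ), Real.one_le_rpow hu (by norm_num), by
      rw [← Real.rpow_natCast, ← Real.rpow_mul hu0.le]; norm_num⟩
  obtain ⟨y, hy, rfl⟩ : ∃ y : ℝ, 1 ≤ y ∧ X = y ^ 10 :=
    ⟨X ^ (1 / 10 : ℝ), Real.one_le_rpow hX (by norm_num), by
      rw [← Real.rpow_natCast, ← Real.rpow_mul hX0.le]; norm_num⟩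
  have conv : ∀ t : ℝ, 1 ≤ t → (t ^ 10) ^ (-(9 / 10) : ℝ) = (t ^ 9)⁻¹ := by
    intro t ht
    have ht0 : 0 ≤ t := by linarith
    rw [← Real.rpow_natCast t 10, ← Real.rpow_mul ht0, ← Real.rpow_natCast t 9,
      ← Real.rpow_neg ht0]
    norm_num
  rw [conv v hv] at h₁
  rw [conv y hy] at h₂
  have hv0 : 0 < v := by linarith
  have hy0 : 0 < y := by linarith
  have h₁' : v ^ 9 * e₁ ≤ 1 := by
    have := mul_le_mul_of_nonneg_left h₁.le (pow_pos hv0 9).le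
    rwa [mul_inv_cancel₀ (pow_pos hv0 9).ne'] at this
  have h₂' : y ^ 9 * e₂ ≤ 1 := by
    have := mul_le_mul_of_nonneg_left h₂.le (pow_pos hy0 9).le
    rwa [mul_inv_cancel₀ (pow_pos hy0 9).ne'] at this
  have hy10 : 1 ≤ y ^ 10 := one_le_pow₀ hy
  -- The 12 is 6 times the 2 from `X + 1 ≤ 2 X`.
  have hvy : v ^ 9 ≤ 12 * y := by
    have s1 : (1 : ℝ) ≤ 12 * (y ^ 10 * (e₁ * e₂)) := by
      have he := mul_nonneg he₁ he₂
      nlinarith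
    calc v ^ 9 = v ^ 9 * 1 := by ring
      _ ≤ v ^ 9 * (12 * (y ^ 10 * (e₁ * e₂))) := mul_le_mul_of_nonneg_left s1 (by positivity)
      _ = 12 * y * ((v ^ 9 * e₁) * (y ^ 9 * e₂)) := by ring
      _ ≤ 12 * y * (1 * 1) := by
          gcongr
      _ = 12 * y := by ring
  calc (v ^ 10) ^ 4 * e₂ = v ^ 40 * e₂ := by ring
    -- The argument would give exponent 81/10 in `u`; 4 is enough later.
    _ ≤ v ^ 81 * e₂ := by gcongr; norm_num
    _ = (v ^ 9) ^ 9 * e₂ := by ring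
    _ ≤ (12 * y) ^ 9 * e₂ := by gcongr
    _ = 12 ^ 9 * (y ^ 9 * e₂) := by ring
    _ ≤ 12 ^ 9 * 1 := by gcongr
    _ = 12 ^ 9 := by ring

/-- A large uniform exponent forces a large ordinary exponent. -/
theorem frequently_simulError_le {α β : ℝ}
    (hind : ∀ a b c : ℤ, (a : ℝ) + b * α + c * β = 0 → a = 0 ∧ b = 0 ∧ c = 0)
    (hunif : ∀ᶠ Q : ℝ in atTop, ∃ q : ℕ, 0 < q ∧ (q : ℝ) ≤ Q ∧
      simulError α β q < Q ^ (-(9 / 10) : ℝ)) :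
    ∃ᶠ q : ℕ in atTop, 0 < q ∧ (q : ℝ) ^ 4 * simulError α β q ≤ 16 * 12 ^ 9 := by
  have hpos : ∀ q, 0 < q → 0 < simulError α β q := fun q hq => simulError_pos hind hq
  have hsmall : ∀ ε > 0, ∃ q, 0 < q ∧ simulError α β q < ε := by
    intro ε hε
    have hlim : ∀ᶠ Q : ℝ in atTop, Q ^ (-(9 / 10) : ℝ) < ε :=
      (tendsto_rpow_neg_atTop (by norm_num : (0 : ℝ) < 9 / 10)).eventually_lt_const hε
    obtain ⟨Q, ⟨q, hq, -, hlt⟩, hQ⟩ := (hunif.and hlim).exists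
    exact ⟨q, hq, hlt.trans hQ⟩
  have hinf := infinite_setOf_isRecord hpos hsmall
  set u : ℕ → ℕ := Nat.nth (IsRecord (simulError α β)) with hu_def
  have hu : StrictMono u := Nat.nth_strictMono hinf
  have hrec : ∀ n, IsRecord (simulError α β) (u n) := Nat.nth_mem_of_infinite hinf
  have hu0 : ∀ n, 0 < u n := fun n => (hrec n).1
  have he : ∀ n, simulError α β (u (n + 1)) < simulError α β (u n) := fun n =>
    (hrec (n + 1)).2 (u n) (hu0 n) (hu n.lt_succ_self)
  obtain ⟨Q₀, hQ₀⟩ := eventually_atTop.1 hunif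
  obtain ⟨N₀, hN₀⟩ := exists_nat_ge Q₀
  have hbound : ∀ n ≥ N₀,
      simulError α β (u n) < ((u (n + 1) : ℝ) - 1) ^ (-(9 / 10) : ℝ) := by
    intro n hn
    have hlt : u n + 1 ≤ u (n + 1) := hu n.lt_succ_self
    have hlt' : (u n : ℝ) + 1 ≤ u (n + 1) := by exact_mod_cast hlt
    have hnu : (n : ℝ) ≤ u n := by exact_mod_cast hu.id_le n
    have hn' : (N₀ : ℝ) ≤ n := by exact_mod_cast hn
    -- With `Q` one below the next record, every admissible `q` precedes that record.
    obtain ⟨q, hq, hqQ, hlt2⟩ := hQ₀ ((u (n + 1) : ℝ) - 1) (by linarith)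
    refine (apply_nth_isRecord_le hinf n q hq ?_).trans_lt hlt2
    have : (q : ℝ) < u (n + 1) := by linarith
    exact_mod_cast this
  rw [frequently_atTop]
  intro N
  obtain ⟨n, hn, hdet⟩ := exists_intDet_ne_zero hind hu he (max N N₀)
  have hnN : N ≤ n := (le_max_left _ _).trans hn
  have hnN₀ : N₀ ≤ n := (le_max_right _ _).trans hn
  refine ⟨u (n + 1), (hnN.trans n.le_succ).trans (hu.id_le _), hu0 _, ?_⟩
  have l01 : u n < u (n + 1) := hu n.lt_succ_self
  have l12 : u (n + 1) < u (n + 2) := hu (n + 1).lt_succ_self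
  have hp := hu0 n
  have habs : (1 : ℝ) ≤ |(intDet (u n) (round ((u n : ℝ) * α)) (round ((u n : ℝ) * β))
        (u (n + 1)) (round ((u (n + 1) : ℝ) * α)) (round ((u (n + 1) : ℝ) * β))
        (u (n + 2)) (round ((u (n + 2) : ℝ) * α)) (round ((u (n + 2) : ℝ) * β)) : ℝ)| := by
    exact_mod_cast Int.one_le_abs hdet
  have hle := habs.trans (abs_intDet_le (α := α) (β := β)
    (L := simulError α β (u n)) (M := simulError α β (u (n + 1)))
    (by omega) (by omega) (by omega) (by omega) (he n).le
    (by exact_mod_cast le_max_left _ _) (by exact_mod_cast le_max_right _ _)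
    (by exact_mod_cast le_max_left _ _) (by exact_mod_cast le_max_right _ _)
    (by exact_mod_cast (le_max_left _ _).trans (he (n + 1)).le)
    (by exact_mod_cast (le_max_right _ _).trans (he (n + 1)).le))
  have r1 : (1 : ℝ) ≤ (u (n + 1) : ℝ) - 1 := by
    have : 2 ≤ u (n + 1) := by omega
    have : (2 : ℝ) ≤ u (n + 1) := by exact_mod_cast this
    linarith
  have r2 : (1 : ℝ) ≤ (u (n + 2) : ℝ) - 1 := by
    have : 2 ≤ u (n + 2) := by omega
    have : (2 : ℝ) ≤ u (n + 2) := by exact_mod_cast this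
    linarith
  have hmain := pow_four_mul_le r1 r2 (hpos _ (hu0 n)).le (hpos _ (hu0 (n + 1))).le
    (hbound n hnN₀) (hbound (n + 1) (hnN₀.trans n.le_succ)) (by
      rw [sub_add_cancel]; exact_mod_cast hle)
  have h0 := (hpos _ (hu0 (n + 1))).le
  calc (u (n + 1) : ℝ) ^ 4 * simulError α β (u (n + 1))
      ≤ (2 * ((u (n + 1) : ℝ) - 1)) ^ 4 * simulError α β (u (n + 1)) := by
        gcongr; linarith
    _ = 16 * (((u (n + 1) : ℝ) - 1) ^ 4 * simulError α β (u (n + 1))) := by ring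
    _ ≤ 16 * 12 ^ 9 := by gcongr

/-! ### Approximating `β - α ^ 2` -/

/-- If `(α, β)` has a large ordinary exponent, then `β - α ^ 2` is well approximable. -/
theorem liouvilleWith_sub_sq {α β C : ℝ} (hirr : Irrational (β - α ^ 2))
    (h : ∃ᶠ q : ℕ in atTop, 0 < q ∧ (q : ℝ) ^ 4 * simulError α β q ≤ C) :
    LiouvilleWith (5 / 2) (β - α ^ 2) := by
  refine ⟨C * (2 + 2 * |α|) + 1, ?_⟩
  have hsq : Tendsto (fun q : ℕ => q ^ 2) atTop atTop := tendsto_pow_atTop (by norm_num)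
  refine hsq.frequently (h.mono ?_)
  rintro q ⟨hq, hle⟩
  have hq1 : (1 : ℝ) ≤ q := by exact_mod_cast hq
  have hq0 : (0 : ℝ) < q := by linarith
  set p := round ((q : ℝ) * α)
  set r := round ((q : ℝ) * β)
  set e := simulError α β q with he
  have h1 : |(q : ℝ) * α - p| ≤ e := le_max_left _ _
  have h2 : |(q : ℝ) * β - r| ≤ e := le_max_right _ _
  have he2 : e ≤ 1 / 2 := simulError_le_half _ _ _
  have he0 : 0 ≤ e := (abs_nonneg _).trans h1
  refine ⟨q * r - p ^ 2, ?_, ?_⟩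
  · have := hirr.ne_rat (((q * r - p ^ 2 : ℤ) : ℚ) / ((q ^ 2 : ℕ) : ℚ))
    push_cast at this ⊢
    exact this
  · have hpow : (((q ^ 2 : ℕ) : ℝ)) ^ (5 / 2 : ℝ) = (q : ℝ) ^ 5 := by
      push_cast
      rw [← Real.rpow_natCast, ← Real.rpow_mul hq0.le, ← Real.rpow_natCast]
      norm_num
    rw [hpow, lt_div_iff₀ (by positivity)]
    have heq : β - α ^ 2 - ((q * r - p ^ 2 : ℤ) : ℝ) / ((q ^ 2 : ℕ) : ℝ) =
        ((q * β - r) - (q * α - p) * (2 * α - (q * α - p) / q)) / q := by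
      push_cast
      field_simp
      ring
    have hin : |2 * α - (q * α - p) / q| ≤ 2 * |α| + 1 := by
      refine (abs_sub _ _).trans ?_
      rw [abs_mul, abs_two, abs_div, Nat.abs_cast]
      have : |(q : ℝ) * α - p| / q ≤ 1 := by
        rw [div_le_one hq0]; linarith
      linarith
    have hnum : |(q * β - r) - (q * α - p) * (2 * α - (q * α - p) / q)| ≤
        e * (2 + 2 * |α|) := by
      refine (abs_sub _ _).trans ?_
      rw [abs_mul]
      have := mul_le_mul h1 hin (abs_nonneg _) he0
      linarith
    rw [heq, abs_div, Nat.abs_cast]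
    calc |(q * β - r) - (q * α - p) * (2 * α - (q * α - p) / q)| / q * (q : ℝ) ^ 5
        = (q : ℝ) ^ 4 * |(q * β - r) - (q * α - p) * (2 * α - (q * α - p) / q)| := by
          field_simp
      _ ≤ (q : ℝ) ^ 4 * (e * (2 + 2 * |α|)) := by gcongr
      _ = ((q : ℝ) ^ 4 * e) * (2 + 2 * |α|) := by ring
      _ ≤ C * (2 + 2 * |α|) := by gcongr
      _ < _ := by linarith

/-! ### Reduction to two coordinates -/

theorem IsTotallyIrrational.int_independent {d : ℕ} {x : Fin d → ℝ} (hx : IsTotallyIrrational x)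
    {i j : Fin d} (hij : i ≠ j) (a b c : ℤ) (h : (a : ℝ) + b * x i + c * x j = 0) :
    a = 0 ∧ b = 0 ∧ c = 0 := by
  by_cases hbc : b = 0 ∧ c = 0
  · obtain ⟨rfl, rfl⟩ := hbc
    refine ⟨?_, rfl, rfl⟩
    simpa using h
  · exfalso
    refine hx _ ⟨Pi.single i (b : ℚ) + Pi.single j (c : ℚ), -a, fun h0 => hbc ?_, rfl⟩ ?_
    · have h1 := congrFun h0 i
      have h2 := congrFun h0 j
      simp [hij, hij.symm] at h1 h2
      exact ⟨h1, h2⟩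
    · have hs : ∀ (l : Fin d) (t : ℚ), ∑ m, ((Pi.single l t : Fin d → ℚ) m : ℝ) * x m = t * x l := by
        intro l t
        rw [Finset.sum_eq_single l]
        · simp
        · intro m _ hm
          simp [hm]
        · simp
      simp only [mem_ofPred_eq, Pi.add_apply, Rat.cast_add, add_mul, Finset.sum_add_distrib, hs]
      push_cast
      linarith

theorem IsUniformlyApproximable.eventually_simulError_lt {d : ℕ} {x : Fin d → ℝ} {s : ℝ}
    (h : IsUniformlyApproximable x s) (i j : Fin d) :
    ∀ᶠ Q : ℝ in atTop, ∃ q : ℕ, 0 < q ∧ (q : ℝ) ≤ Q ∧ simulError (x i) (x j) q < Q ^ (-s) := by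
  filter_upwards [h] with Q hQ
  obtain ⟨p, q, hq, hqQ, hlt⟩ := hQ
  lift q to ℕ using hq.le
  refine ⟨q, by exact_mod_cast hq, by exact_mod_cast hqQ, ?_⟩
  have hcoord : ∀ l, |(q : ℝ) * x l - round ((q : ℝ) * x l)| < Q ^ (-s) := by
    intro l
    have hl := (norm_le_pi_norm (((q : ℤ) : ℝ) • x - fun i => (p i : ℝ)) l).trans_lt hlt
    exact (round_le _ (p l)).trans_lt (by simpa using hl)
  exact max_lt (hcoord i) (hcoord j)

theorem IsUniformlyApproximable.mono {d : ℕ} {x : Fin d → ℝ} {s t : ℝ}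
    (h : IsUniformlyApproximable x s) (hts : t ≤ s) : IsUniformlyApproximable x t := by
  filter_upwards [h, eventually_ge_atTop 1] with Q ⟨p, q, hq, hqQ, hlt⟩ hQ
  exact ⟨p, q, hq, hqQ, hlt.trans_le (Real.rpow_le_rpow_of_exponent_le hQ (neg_le_neg hts))⟩

theorem isUniformlyApproximable_of_lt_uniformExponent {d : ℕ} {x : Fin d → ℝ} {t : ℝ}
    (h : (t : EReal) < uniformExponent x) : IsUniformlyApproximable x t := by
  obtain ⟨_, ⟨s, rfl, hs⟩, hlt⟩ := lt_sSup_iff.1 h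
  exact hs.mono (EReal.coe_lt_coe_iff.1 hlt).le

/-- A totally irrational vector of large uniform exponent lies on no paraboloid
`x j = (x i) ^ 2 + c` unless `c` is rational or well approximable. -/
theorem liouvilleWith_of_mem_totallyIrrationalUniformSet {d : ℕ} {x : Fin d → ℝ}
    (hx : x ∈ totallyIrrationalUniformSet d (19 / 20)) {i j : Fin d} (hij : i ≠ j) {c : ℝ}
    (hc : Irrational c) (hxc : x j = x i ^ 2 + c) : LiouvilleWith (5 / 2) c := by
  obtain ⟨hs, hirr⟩ := hx
  -- The supremum need not be attained, hence the drop from 19/20 to 9/10.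
  have hlt : ((9 / 10 : ℝ) : EReal) < uniformExponent x :=
    lt_of_lt_of_le (EReal.coe_lt_coe_iff.2 (by norm_num)) hs
  have hcx : x j - x i ^ 2 = c := by rw [hxc]; ring
  rw [← hcx] at hc ⊢
  exact liouvilleWith_sub_sq hc (frequently_simulError_le (hirr.int_independent hij)
    ((isUniformlyApproximable_of_lt_uniformExponent hlt).eventually_simulError_lt i j))

/-! ### The manifolds -/

/-- The polynomial map with components `t ^ (i - k + 2) + c` for `i ≥ k` and `0` for `i < k`. -/
noncomputable def momentMap {d : ℕ} (k : ℕ) (c t : ℝ) (i : Fin d) : ℝ :=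
  if k ≤ (i : ℕ) then t ^ ((i : ℕ) - k + 2) + c else 0

/-- The submanifold of `ℝ^d` cut out by `x i = (x 0) ^ (i - k + 2) + c` for `i ≥ k`. -/
def momentManifold {d : ℕ} (k : ℕ) (z : Fin d) (c : ℝ) : Set (Fin d → ℝ) :=
  {x | ∀ i : Fin d, k ≤ (i : ℕ) → x i = momentMap k c (x z) i}

theorem momentMap_of_lt {d k : ℕ} {i : Fin d} (h : (i : ℕ) < k) (c t : ℝ) :
    momentMap k c t i = 0 := if_neg (not_le.2 h)

theorem momentMap_of_le {d k : ℕ} {i : Fin d} (h : k ≤ (i : ℕ)) (c t : ℝ) :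
    momentMap k c t i = t ^ ((i : ℕ) - k + 2) + c := if_pos h

theorem continuous_momentMap {d : ℕ} (k : ℕ) (c : ℝ) (i : Fin d) :
    Continuous fun t => momentMap k c t i := by
  unfold momentMap
  split_ifs <;> fun_prop

theorem analyticAt_momentMap {d : ℕ} (k : ℕ) (c : ℝ) (i z : Fin d) (x : Fin d → ℝ) :
    AnalyticAt ℝ (fun y : Fin d → ℝ => momentMap k c (y z) i) x := by
  have hz : AnalyticAt ℝ (fun y : Fin d → ℝ => y z) x :=
    (ContinuousLinearMap.proj (R := ℝ) (φ := fun _ : Fin d => ℝ) z).analyticAt x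
  unfold momentMap
  split_ifs
  · exact (hz.pow _).add analyticAt_const
  · exact analyticAt_const

/-- The shear of `ℝ^d` that straightens `momentManifold`. -/
noncomputable def momentShear {d : ℕ} (k : ℕ) (z : Fin d) (hz : (z : ℕ) < k) (c : ℝ) :
    (Fin d → ℝ) ≃ₜ (Fin d → ℝ) where
  toFun x i := x i - momentMap k c (x z) i
  invFun y i := y i + momentMap k c (y z) i
  left_inv x := by ext i; simp [momentMap_of_lt hz]
  right_inv y := by ext i; simp [momentMap_of_lt hz]
  continuous_toFun := continuous_pi fun i =>
    (continuous_apply i).sub ((continuous_momentMap k c i).comp (continuous_apply z))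
  continuous_invFun := continuous_pi fun i =>
    (continuous_apply i).add ((continuous_momentMap k c i).comp (continuous_apply z))

theorem isAnalyticSubmanifold_momentManifold {d k : ℕ} {z : Fin d} (hz : (z : ℕ) < k)
    (hkd : k ≤ d) (c : ℝ) : IsAnalyticSubmanifold k (momentManifold k z c) := by
  have hproj : ∀ (i : Fin d) (x : Fin d → ℝ), AnalyticAt ℝ (fun y : Fin d → ℝ => y i) x :=
    fun i x => (ContinuousLinearMap.proj (R := ℝ) (φ := fun _ : Fin d => ℝ) i).analyticAt x
  refine ⟨hkd, fun x _ => ⟨(momentShear k z hz c).toOpenPartialHomeomorph, mem_univ _, ?_, ?_, ?_⟩⟩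
  · exact fun y _ => analyticAt_pi_iff.2 fun i => (hproj i y).sub (analyticAt_momentMap k c i z y)
  · exact fun y _ => analyticAt_pi_iff.2 fun i => (hproj i y).add (analyticAt_momentMap k c i z y)
  · intro y _
    exact forall₂_congr fun i _ => sub_eq_zero.symm

theorem isConnected_momentManifold {d k : ℕ} {z : Fin d} (hz : (z : ℕ) < k) (c : ℝ) :
    IsConnected (momentManifold k z c) := by
  have hflat : IsConnected {y : Fin d → ℝ | ∀ i : Fin d, k ≤ (i : ℕ) → y i = 0} := by
    refine ⟨⟨0, fun _ _ => rfl⟩, Convex.isPreconnected ?_⟩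
    intro x hx y hy a b _ _ _ i hi
    simp [hx i hi, hy i hi]
  have himage : momentManifold k z c = (momentShear k z hz c).symm ''
      {y : Fin d → ℝ | ∀ i : Fin d, k ≤ (i : ℕ) → y i = 0} := by
    rw [Homeomorph.image_symm]
    ext x
    exact forall₂_congr fun i _ => sub_eq_zero.symm
  rw [himage]
  exact hflat.image _ (momentShear k z hz c).symm.continuous.continuousOn

/-- The point of `momentManifold` with prescribed free coordinates. -/
theorem add_momentMap_mem {d k : ℕ} {z : Fin d} (hz : (z : ℕ) < k) (c : ℝ) {y : Fin d → ℝ}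
    (hy : ∀ i : Fin d, k ≤ (i : ℕ) → y i = 0) :
    (fun i => y i + momentMap k c (y z) i) ∈ momentManifold k z c := by
  intro i hi
  simp [hy i hi, momentMap_of_lt hz]

/-- Moving one free coordinate other than `z` kills its coefficient. The rest is a polynomial
identity in `x z` whose exponents 1 and `i - k + 2` are distinct; `c` enters only the constant term.
-/
theorem not_momentManifold_subset {d k : ℕ} {z : Fin d} (hz : (z : ℕ) < k) (c : ℝ)
    {H : Set (Fin d → ℝ)} (hH : IsRationalHyperplane H) : ¬ momentManifold k z c ⊆ H := by
  classical
  obtain ⟨a, b, ha, rfl⟩ := hH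
  intro hsub
  have heq : ∀ y : Fin d → ℝ, (∀ i : Fin d, k ≤ (i : ℕ) → y i = 0) →
      ∑ i, (a i : ℝ) * y i + ∑ i, (a i : ℝ) * momentMap k c (y z) i = b := by
    intro y hy
    rw [← Finset.sum_add_distrib, ← hsub (add_momentMap_mem hz c hy)]
    simp only [mul_add]
  have hsingle : ∀ (l : Fin d) (t : ℝ), (l : ℕ) < k →
      (a l : ℝ) * t + ∑ i, (a i : ℝ) * momentMap k c ((Pi.single l t : Fin d → ℝ) z) i = b := by
    intro l t hl
    have := heq (Pi.single l t) (fun i hi => by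
      have : i ≠ l := fun h => by subst h; omega
      simp [this])
    rwa [Finset.sum_eq_single l (fun m _ hm => by simp [hm]) (by simp), Pi.single_eq_same] at this
  have hpoly : ∀ t : ℝ, (a z : ℝ) * t + ∑ i, (a i : ℝ) * momentMap k c t i = b := by
    intro t
    simpa using hsingle z t hz
  have hfree : ∀ l : Fin d, (l : ℕ) < k → l ≠ z → a l = 0 := by
    intro l hl hlz
    have h1 := hsingle l 1 hl
    have h0 := hpoly 0
    rw [Pi.single_eq_of_ne hlz.symm] at h1
    have : (a l : ℝ) = 0 := by linarith
    exact_mod_cast this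
  let p : Polynomial ℝ := Polynomial.C (a z : ℝ) * Polynomial.X +
    ∑ i : Fin d, (if k ≤ (i : ℕ) then
      Polynomial.C (a i : ℝ) * (Polynomial.X ^ ((i : ℕ) - k + 2) + Polynomial.C c) else 0)
  have hp : p = Polynomial.C (b : ℝ) := by
    refine Polynomial.funext fun t => ?_
    rw [Polynomial.eval_C, ← hpoly t]
    simp only [p, Polynomial.eval_add, Polynomial.eval_mul, Polynomial.eval_C, Polynomial.eval_X,
      Polynomial.eval_finsetSum]
    congr 1
    refine Finset.sum_congr rfl fun i _ => ?_
    unfold momentMap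
    split_ifs <;> simp
  have hcoeff : ∀ n, p.coeff (n + 1) = 0 := fun n => by
    rw [hp, Polynomial.coeff_C, if_neg n.succ_ne_zero]
  apply ha
  funext l
  rw [Pi.zero_apply]
  have hz0 : a z = 0 := by
    have h := hcoeff 0
    simp only [p, Polynomial.coeff_add, Polynomial.coeff_C_mul, Polynomial.finsetSum_coeff,
      Polynomial.coeff_X] at h
    rw [Finset.sum_eq_zero] at h
    · simpa using h
    · intro i _
      split_ifs
      · simp [Polynomial.coeff_X_pow]
      · simp
  by_cases hl : k ≤ (l : ℕ)
  · have h := hcoeff ((l : ℕ) - k + 1)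
    simp only [p, Polynomial.coeff_add, Polynomial.coeff_C_mul, Polynomial.finsetSum_coeff,
      Polynomial.coeff_X] at h
    rw [Finset.sum_eq_single l] at h
    · simpa [hl, hz0, Polynomial.coeff_X_pow, Polynomial.coeff_C] using h
    · intro i _ hil
      split_ifs with hi
      · have : (i : ℕ) ≠ l := fun h => hil (Fin.ext h)
        have : (l : ℕ) - k ≠ (i : ℕ) - k := by omega
        simp [Polynomial.coeff_X_pow, this]
      · simp
    · simp
  · by_cases hlz : l = z
    · rw [hlz, hz0]
    · exact hfree l (not_le.1 hl) hlz

/-- The point with all free coordinates 0 has `k`-th coordinate `c`. -/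
theorem momentManifold_injective {d k : ℕ} {z : Fin d} (hz : (z : ℕ) < k) (hkd : k < d) :
    Function.Injective (momentManifold k z) := by
  intro c c' h
  have hmem := add_momentMap_mem (k := k) hz c (y := (0 : Fin d → ℝ)) (fun _ _ => rfl)
  rw [h] at hmem
  have := hmem ⟨k, hkd⟩ le_rfl
  simpa [momentMap_of_lt hz, momentMap_of_le] using this

/-! ### Choice of the parameter `c` -/

/-- The set has full Lebesgue measure, since 5/2 > 2, while countable sets are null. -/
theorem not_countable_setOf_irrational_not_liouvilleWith :
    ¬ {c : ℝ | Irrational c ∧ ¬ LiouvilleWith (5 / 2) c}.Countable := by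
  intro hcount
  have hae : ∀ᵐ c : ℝ, Irrational c ∧ ¬ LiouvilleWith (5 / 2) c := by
    have h1 : ∀ᵐ c : ℝ, c ∉ Set.range ((↑) : ℚ → ℝ) :=
      (Set.countable_range _).ae_notMem _
    filter_upwards [h1, ae_not_liouvilleWith] with c hc hl
    exact ⟨hc, hl _ (by norm_num)⟩
  obtain ⟨c, hc, hc'⟩ := (hae.and (hcount.ae_notMem MeasureTheory.volume)).exists
  exact hc' hc

theorem mainTheorem9 :
    ∃ σ : ℝ, 0 < σ ∧ σ < 1 ∧
      ∀ d k : ℕ, 1 ≤ k → k < d →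
        ¬ Set.Countable {M : Set (Fin d → ℝ) |
            IsConnected M ∧
            IsAnalyticSubmanifold k M ∧
            (∀ H : Set (Fin d → ℝ), IsRationalHyperplane H → ¬ M ⊆ H) ∧
            M ∩ totallyIrrationalUniformSet d σ = ∅} := by
  refine ⟨19 / 20, by norm_num, by norm_num, fun d k hk hkd hcount => ?_⟩
  let z : Fin d := ⟨0, by omega⟩
  have hz : (z : ℕ) < k := hk
  refine not_countable_setOf_irrational_not_liouvilleWith
    (Set.MapsTo.countable_of_injOn (f := momentManifold k z) ?_
      (momentManifold_injective hz hkd).injOn hcount)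
  rintro c ⟨hirr, hc⟩
  refine ⟨isConnected_momentManifold hz c, isAnalyticSubmanifold_momentManifold hz hkd.le c,
    fun H hH => not_momentManifold_subset hz c hH, ?_⟩
  refine Set.eq_empty_of_forall_notMem fun x ⟨hxM, hx⟩ => hc ?_
  refine liouvilleWith_of_mem_totallyIrrationalUniformSet (i := z) (j := ⟨k, hkd⟩) hx
    (fun h => ?_) hirr ?_
  · have := congrArg Fin.val h
    simp only [z] at this
    omega
  · have := hxM ⟨k, hkd⟩ le_rfl
    simpa [momentMap_of_le] using this
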